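/- Let $n,m,q_1,\dots,q_n$ be nonnegative integers, let $\Omega_i\subset\mathbb R^{q_i}$, $f^i$, $W_i\in\mathbb R^{m\times q_i}$ ($i=1,\dots,n$) and $d_0\in\mathbb R^m$ be given, put $\Omega=\prod_{i=1}^n\Omega_i$, and consider the extended monotropic optimization (EMO) problem $$\min\ f(x)=\sum_{i=1}^n f^i(x_i)\quad\text{subject to}\quad \sum_{i=1}^n W_ix_i=d_0,\qquad x_i\in\Omega_i,\ i=1,\dots,n .$$ Let $\mathcal G$ be a weighted undirected graph on $\{1,\dots,n\}$ with symmetric nonnegative weighted adjacency matrix $[a_{i,j}]$, where $a_{i,j}>0$ exactly when $\{j,i\}$ is an edge, and let $d_1,\dots,d_n\in\mathbb R^m$ satisfy $\sum_{i=1}^n d_i=d_0$. Assumption 1: (1) $\mathcal G$ is connected; (2) for every $i$, $\Omega_i$ is closed and convex and $f^i$ is a real-valued function that is strictly convex on an open (convex) set containing $\Omega_i$; (3) (Slater) there is $x\in\Omega^\circ$ (the interior of $\Omega$) with $\sum_i W_ix_i=d_0$. Write $P_{\Omega_i}$ for the Euclidean projection onto $\Omega_i$ and $\partial f^i$ for the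 Clarke generalized gradient. For $x\in\prod_i\mathbb R^{q_i}$ and $\lambda,z\in(\mathbb R^m)^n$ let $\mathcal F(x,\lambda,z)$ be the set of all $(p,\mu,\zeta)$ for which there are $g_i\in\partial f^i(x_i)$ such that, for all $i$, $$p_i=P_{\Omega_i}\big[x_i-g_i+W_i^{\rm T}\lambda_i\big]-x_i,$$ $$\mu_i=d_i-W_ix_i-\sum_{j=1}^n a_{i,j}(\lambda_i-\lambda_j)-\sum_{j=1}^n a_{i,j}(z_i-z_j)-W_ip_i,\qquad \zeta_i=\sum_{j=1}^n a_{i,j}(\lambda_i-\lambda_j).$$ The distributed derivative feedback algorithm (DDFA) is the differential inclusion $(\dot x,\dot\lambda,\dot z)\in\mathcal F(x,\lambda,z)$, $t\ge 0$, with $x(0)\in\Omega$ and $\lambda(0),z(0)$ arbitrary; a solution is a function of $t\in[0,\infty)$ that is absolutely continuous on every $[0,\tau]$ and satisfies the inclusion for almost all $t\ge0$. Assumption 2: $\mathcal F(x,\lambda,z)$ is convex for all $(x,\lambda,z)\in\Omega\times(\mathbb R^m)^n\times(\mathbb R^m)^n$. Theorem. Suppose that Assumptions 1 and 2 hold and that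 the EMO problem has an optimal solution. Then its optimal solution $x^*$ is unique, and (i) every solution $(x(t),\lambda(t),z(t))$ of the DDFA is bounded on $[0,\infty)$; (ii) for every solution of the DDFA, $x(t)\to x^*$ as $t\to\infty$. -/

import Mathlib

open Set Filter Topology MeasureTheory

noncomputable section

namespace EMO

/-- The Euclidean space `ℝᵏ`. -/
abbrev Vec (k : ℕ) : Type := EuclideanSpace ℝ (Fin k)

/-! ### Convex analysis -/

/-- Clarke's generalized directional derivative
`f°(x; v) = limsup_{y → x, t ↓ 0} (f (y + t v) - f y) / t`, as an extended real number. -/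
def clarkeDeriv {k : ℕ} (f : Vec k → ℝ) (x v : Vec k) : EReal :=
  limsup (fun s : Vec k × ℝ => (((f (s.1 + s.2 • v) - f s.1) / s.2 : ℝ) : EReal))
    (𝓝 x ×ˢ 𝓝[>] (0 : ℝ))

/-- The Clarke generalized gradient `∂f(x) = {g : ⟨g, v⟩ ≤ f°(x; v) for all v}`. It depends only on
the values of `f` near `x`. -/
def clarkeGradient {k : ℕ} (f : Vec k → ℝ) (x : Vec k) : Set (Vec k) :=
  {g | ∀ v : Vec k, ((inner ℝ g v : ℝ) : EReal) ≤ clarkeDeriv f x v}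

/-- `v` is a point of `Ω` at minimal Euclidean distance from `u`. -/
def IsNearestPoint {k : ℕ} (Ω : Set (Vec k)) (u v : Vec k) : Prop :=
  v ∈ Ω ∧ ∀ w ∈ Ω, ‖u - v‖ ≤ ‖u - w‖

/-- The projection `P_Ω(u) = argmin_{v ∈ Ω} ‖u - v‖`. -/
def proj {k : ℕ} (Ω : Set (Vec k)) (u : Vec k) : Vec k :=
  Classical.epsilon (IsNearestPoint Ω u)

/-- On a nonempty closed convex set the projection is the unique nearest point. -/
theorem eq_proj_iff {k : ℕ} {Ω : Set (Vec k)} (hne : Ω.Nonempty) (hcl : IsClosed Ω)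
    (hcv : Convex ℝ Ω) (u v : Vec k) : v = proj Ω u ↔ IsNearestPoint Ω u v := by
  have key : ∀ w, IsNearestPoint Ω u w ↔ w ∈ Ω ∧ ‖u - w‖ = ⨅ y : Ω, ‖u - y‖ := by
    intro w
    have : Nonempty Ω := hne.to_subtype
    have hbdd : BddBelow (range fun y : Ω => ‖u - y‖) :=
      ⟨0, forall_mem_range.2 fun _ => norm_nonneg _⟩
    refine and_congr_right fun hw => ⟨fun h => ?_, fun h y hy => ?_⟩
    · exact le_antisymm (le_ciInf fun y => h y y.2) (ciInf_le hbdd ⟨w, hw⟩)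
    · rw [h]
      exact ciInf_le hbdd ⟨y, hy⟩
  obtain ⟨w, hw, hwu⟩ := exists_norm_eq_iInf_of_complete_convex hne hcl.isComplete hcv u
  have hp : IsNearestPoint Ω u (proj Ω u) :=
    Classical.epsilon_spec (p := IsNearestPoint Ω u) ⟨w, (key w).2 ⟨hw, hwu⟩⟩
  refine ⟨fun h => h ▸ hp, fun h => ?_⟩
  have h1 := (norm_eq_iInf_iff_real_inner_le_zero hcv h.1).1 ((key v).1 h).2 _ hp.1
  have h2 := (norm_eq_iInf_iff_real_inner_le_zero hcv hp.1).1 ((key _).1 hp).2 _ h.1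
  set q := proj Ω u
  have h3 : inner ℝ (v - q) (v - q) ≤ 0 := by
    have e : inner ℝ (v - q) (v - q) = inner ℝ (u - v) (q - v) + inner ℝ (u - q) (v - q) := by
      rw [← neg_sub v q, inner_neg_right, ← sub_eq_neg_add, ← inner_sub_left]
      congr 1
      abel
    linarith
  rw [real_inner_self_eq_norm_sq] at h3
  exact sub_eq_zero.1 (norm_eq_zero.1 (pow_eq_zero_iff two_ne_zero |>.1 (le_antisymm h3 (sq_nonneg _))))

/-! ### Graphs -/

/-- A weighted undirected graph on the nodes `1, …, n`, given by its weighted adjacency matrix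
`a`: a symmetric nonnegative matrix, where `a i j > 0` exactly when `{j, i}` is an edge. -/
structure WeightedGraph (n : ℕ) where
  a : Matrix (Fin n) (Fin n) ℝ
  symm : ∀ i j, a i j = a j i
  nonneg : ∀ i j, 0 ≤ a i j

/-- Any two nodes are joined by a path of edges. -/
def WeightedGraph.Connected {n : ℕ} (G : WeightedGraph n) : Prop :=
  (SimpleGraph.fromRel fun i j => 0 < G.a i j).Connected

/-- The `i`-th block `∑ⱼ a i j (μᵢ - μⱼ)` of `(Lₙ ⊗ Iₘ) μ`, with `Lₙ` the graph Laplacian. -/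
def WeightedGraph.lap {n m : ℕ} (G : WeightedGraph n) (μ : Fin n → Vec m) (i : Fin n) : Vec m :=
  ∑ j, G.a i j • (μ i - μ j)

/-! ### The optimization problem -/

/-- The data of the problem
`min ∑ᵢ fᵢ(xᵢ)` subject to `∑ᵢ Wᵢ xᵢ = d₀`, `xᵢ ∈ Ωᵢ`. -/
structure Problem (n m : ℕ) (q : Fin n → ℕ) where
  f : (i : Fin n) → Vec (q i) → ℝ
  Ω : (i : Fin n) → Set (Vec (q i))
  W : (i : Fin n) → Matrix (Fin m) (Fin (q i)) ℝ
  d₀ : Vec m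

variable {n m : ℕ} {q : Fin n → ℕ}

/-- The product `Ω₁ × ⋯ × Ωₙ`. -/
def Problem.feasibleBox (P : Problem n m q) : Set ((i : Fin n) → Vec (q i)) :=
  Set.pi univ P.Ω

/-- The global objective `f(x) = ∑ᵢ fᵢ(xᵢ)`. -/
def Problem.objective (P : Problem n m q) (x : (i : Fin n) → Vec (q i)) : ℝ :=
  ∑ i, P.f i (x i)

/-- `Wᵢ xᵢ`. -/
def Problem.applyW (P : Problem n m q) (i : Fin n) (x : Vec (q i)) : Vec m :=
  (P.W i).toEuclideanLin x

/-- `Wᵢᵀ μ`. -/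
def Problem.applyWT (P : Problem n m q) (i : Fin n) (μ : Vec m) : Vec (q i) :=
  (P.W i).transpose.toEuclideanLin μ

/-- The global equality constraint `Wx = ∑ᵢ Wᵢ xᵢ = d₀`. -/
def Problem.EqConstraint (P : Problem n m q) (x : (i : Fin n) → Vec (q i)) : Prop :=
  ∑ i, P.applyW i (x i) = P.d₀

/-- `x` is an optimal solution of the problem. -/
def Problem.IsOptimal (P : Problem n m q) (x : (i : Fin n) → Vec (q i)) : Prop :=
  x ∈ P.feasibleBox ∧ P.EqConstraint x ∧
    ∀ y ∈ P.feasibleBox, P.EqConstraint y → P.objective x ≤ P.objective y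

/-- The standing assumption: connected undirected graph; each `Ωᵢ` closed and convex, each `fᵢ`
strictly convex on an open set containing `Ωᵢ`; and Slater's condition. -/
structure StandingAssumption (G : WeightedGraph n) (P : Problem n m q) : Prop where
  connected : G.Connected
  strictConvex : ∀ i, ∃ U : Set (Vec (q i)), IsOpen U ∧ P.Ω i ⊆ U ∧ StrictConvexOn ℝ U (P.f i)
  closed : ∀ i, IsClosed (P.Ω i)
  convex : ∀ i, Convex ℝ (P.Ω i)
  slater : ∃ x ∈ interior P.feasibleBox, P.EqConstraint x

/-! ### Differential inclusions and the algorithm -/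

/-- `φ` is a solution on `[0, ∞)` of the differential inclusion `φ'(t) ∈ F(φ(t))`: it is absolutely
continuous on every `[0, τ]` and satisfies the inclusion for almost all `t ≥ 0`. -/
def IsSolution {S : Type*} [NormedAddCommGroup S] [NormedSpace ℝ S] (F : S → Set S)
    (φ : ℝ → S) : Prop :=
  (∀ τ > 0, AbsolutelyContinuousOnInterval φ 0 τ) ∧
    ∀ᵐ t ∂(volume.restrict (Ici (0 : ℝ))), ∃ v ∈ F (φ t), HasDerivAt φ v t

/-- States `(x, λ, z)` of the network. -/
abbrev State (n m : ℕ) (q : Fin n → ℕ) : Type :=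
  ((i : Fin n) → Vec (q i)) × (Fin n → Vec m) × (Fin n → Vec m)

/-- The set-valued right-hand side of the distributed derivative feedback algorithm; the velocity
`v.1` is the vector `p` that is fed back in the `λ`-equation. -/
def ddfa (G : WeightedGraph n) (P : Problem n m q) (d : Fin n → Vec m) (s : State n m q) :
    Set (State n m q) :=
  {v | ∃ g : (i : Fin n) → Vec (q i), (∀ i, g i ∈ clarkeGradient (P.f i) (s.1 i)) ∧
    (∀ i, v.1 i = proj (P.Ω i) (s.1 i - g i + P.applyWT i (s.2.1 i)) - s.1 i) ∧
    (∀ i, v.2.1 i = d i - P.applyW i (s.1 i) - G.lap s.2.1 i - G.lap s.2.2 i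
      - P.applyW i (v.1 i)) ∧
    (∀ i, v.2.2 i = G.lap s.2.1 i)}

end EMO

end

/-! Slater's condition gives a multiplier `l` for which the duality gap `h(x) = f(x) - f(xs) - ⟨l,
W(x - xs)⟩` is nonnegative on the box; strict convexity makes it vanish only at `xs`. With `zs`
solving `L zs = d - W xs` (solvable on a connected graph), the Lyapunov function is `u = h + ½
dist²` to `(xs, l, zs)`. The derivative feedback cancels the cross terms, and `dissipation` gives
`u' ≤ -h`. So `u` decreases, which bounds every solution.

Since `h' ≤ C` on bounded sets (`gap_rate_le`), the one-sided Barbalat lemma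
`tendsto_zero_of_dissipation` gives `h → 0`, and compactness turns this into `x → xs`.

No nonsmooth chain rule is needed: a subgradient at the current point gives an affine minorant of
`h` touching it there, and wherever `h` is differentiable along the curve its derivative is the
slope of that minorant. -/

section Analysis

/-! ### Absolutely continuous curves and lower supports -/

/-- Composition of an absolutely continuous curve with a locally Lipschitz function. -/
theorem AbsolutelyContinuousOnInterval.comp_lipschitzOnWith {X Y : Type*} [PseudoMetricSpace X]
    [PseudoMetricSpace Y] {φ : ℝ → X} {V : X → Y} {a b : ℝ} {K : NNReal} {s : Set X}
    (hφ : AbsolutelyContinuousOnInterval φ a b) (hV : LipschitzOnWith K V s)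
    (hs : MapsTo φ (uIcc a b) s) : AbsolutelyContinuousOnInterval (fun t => V (φ t)) a b := by
  rw [absolutelyContinuousOnInterval_iff] at hφ ⊢
  intro ε hε
  -- `K` may be zero, so the division is by `K + 1`.
  obtain ⟨δ, hδ, h⟩ := hφ (ε / (K + 1)) (by positivity)
  refine ⟨δ, hδ, fun E hE hlt => ?_⟩
  have hK : (0 : ℝ) < K + 1 := by positivity
  calc ∑ i ∈ Finset.range E.1, dist (V (φ (E.2 i).1)) (V (φ (E.2 i).2))
      ≤ ∑ i ∈ Finset.range E.1, (K + 1) * dist (φ (E.2 i).1) (φ (E.2 i).2) := by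
        refine Finset.sum_le_sum fun i hi => ?_
        refine (hV.dist_le_mul _ (hs (hE.1 i hi).1) _ (hs (hE.1 i hi).2)).trans ?_
        gcongr
        simp
    _ = (K + 1) * ∑ i ∈ Finset.range E.1, dist (φ (E.2 i).1) (φ (E.2 i).2) := by
        rw [Finset.mul_sum]
    _ < (K + 1) * (ε / (K + 1)) := by gcongr; exact h E hE hlt
    _ = ε := by field_simp

theorem AbsolutelyContinuousOnInterval.comp_locallyLipschitzOn {X Y : Type*}
    [NormedAddCommGroup X] [MetricSpace Y] {φ : ℝ → X} {V : X → Y} {a b : ℝ} {s : Set X}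
    (hφ : AbsolutelyContinuousOnInterval φ a b) (hV : LocallyLipschitzOn s V)
    (hs : MapsTo φ (uIcc a b) s) : AbsolutelyContinuousOnInterval (fun t => V (φ t)) a b := by
  have hc : IsCompact (φ '' uIcc a b) := isCompact_uIcc.image_of_continuousOn hφ.continuousOn
  obtain ⟨K, hK⟩ := (hV.mono hs.image_subset).exists_lipschitzOnWith_of_compact hc
  exact hφ.comp_lipschitzOnWith hK (mapsTo_image _ _)

/-- An absolutely continuous function whose derivative is almost everywhere nonpositive decreases. -/
theorem AbsolutelyContinuousOnInterval.le_of_deriv_nonpos {u : ℝ → ℝ} {a b : ℝ} (hab : a ≤ b)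
    (hu : AbsolutelyContinuousOnInterval u a b)
    (h : ∀ᵐ t, t ∈ Icc a b → deriv u t ≤ 0) : u b ≤ u a := by
  have h1 := hu.integral_deriv_eq_sub
  have h2 : ∫ t in a..b, deriv u t ≤ 0 := by
    have h3 : 0 ≤ ∫ t in a..b, -deriv u t := by
      refine intervalIntegral.integral_nonneg_of_ae_restrict hab ?_
      refine (ae_restrict_iff' measurableSet_Icc).2 ?_
      filter_upwards [h] with t ht hm
      simpa using ht hm
    rw [intervalIntegral.integral_neg] at h3
    linarith
  linarith

/-- A differentiable function that is supported from below by a differentiable function has the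
same derivative at the point of contact. -/
theorem deriv_eq_of_lower_support {u k : ℝ → ℝ} {κ t : ℝ} (hu : DifferentiableAt ℝ u t)
    (hk : HasDerivAt k κ t) (heq : k t = u t) (hle : ∀ᶠ s in 𝓝 t, k s ≤ u s) :
    deriv u t = κ := by
  have hmin : IsLocalMin (fun s => u s - k s) t := by
    filter_upwards [hle] with s hs
    linarith
  have := hmin.hasDerivAt_eq_zero (hu.hasDerivAt.sub hk)
  linarith

/-- If almost everywhere an absolutely continuous function has a lower support of nonpositive
slope, then it decreases. -/
theorem AbsolutelyContinuousOnInterval.le_of_lower_support {u : ℝ → ℝ} {a b : ℝ} (hab : a ≤ b)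
    (hu : AbsolutelyContinuousOnInterval u a b)
    (h : ∀ᵐ t, t ∈ Ioo a b → ∃ k κ, HasDerivAt k κ t ∧ k t = u t ∧ (∀ᶠ s in 𝓝 t, k s ≤ u s) ∧
      κ ≤ 0) : u b ≤ u a := by
  refine hu.le_of_deriv_nonpos hab ?_
  filter_upwards [h, hu.ae_differentiableAt,
    compl_mem_ae_iff.2 (measure_singleton (μ := (volume : Measure ℝ)) a),
    compl_mem_ae_iff.2 (measure_singleton (μ := (volume : Measure ℝ)) b)] with t ht hd ha hb hm
  obtain ⟨k, κ, h1, h2, h3, h4⟩ := ht ⟨lt_of_le_of_ne hm.1 (Ne.symm ha), lt_of_le_of_ne hm.2 hb⟩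
  rw [deriv_eq_of_lower_support (hd (by rwa [uIcc_of_le hab])) h1 h2 h3]
  exact h4

/-! ### Lagrange multipliers -/

/-- Strong duality: a convex program with affine equality constraints that has a feasible point in
the interior of its domain admits a Lagrange multiplier. -/
theorem exists_lagrange_multiplier {E F : Type*} [NormedAddCommGroup E] [NormedSpace ℝ E]
    [FiniteDimensional ℝ E] [NormedAddCommGroup F] [InnerProductSpace ℝ F] [FiniteDimensional ℝ F]
    {f : E → ℝ} {S : Set E} (hf : ConvexOn ℝ S f) (W : E →ₗ[ℝ] F) {xs x₀ : E}
    (hx₀ : x₀ ∈ interior S) (hW : W x₀ = W xs) (hopt : ∀ y ∈ S, W y = W xs → f xs ≤ f y) :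
    ∃ l : F, ∀ x ∈ S, f xs + inner ℝ l (W (x - xs)) ≤ f x := by
  have hfi : ConvexOn ℝ (interior S) f := hf.subset interior_subset hf.1.interior
  have hcont : ContinuousOn f (interior S) := hfi.continuousOn isOpen_interior
  -- `A` is the strict epigraph over the interior only, so that it is open and can be separated from
  -- the affine slice `B`.
  set A : Set (E × ℝ) := {p | p.1 ∈ interior S ∧ f p.1 - f xs < p.2} with hA
  set B : Set (E × ℝ) := {p | W p.1 = W xs ∧ p.2 = 0} with hB
  have hAc : Convex ℝ A := by
    have := (hfi.add_const (-f xs)).convex_strict_epigraph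
    simpa [hA, sub_eq_add_neg] using this
  have hAo : IsOpen A := by
    have h1 : ContinuousOn (fun p : E × ℝ => p.2 - (f p.1 - f xs)) (interior S ×ˢ univ) := by
      refine continuousOn_snd.sub (ContinuousOn.sub ?_ continuousOn_const)
      exact hcont.comp continuousOn_fst fun p hp => hp.1
    have h2 := h1.isOpen_inter_preimage (isOpen_interior.prod isOpen_univ) (isOpen_Ioi (a := (0:ℝ)))
    convert h2 using 1
    ext p
    simp [hA]
  have hBc : Convex ℝ B := by
    rintro p ⟨hp1, hp2⟩ r ⟨hr1, hr2⟩ a b _ _ hab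
    refine ⟨?_, by simp [hp2, hr2]⟩
    simp [hp1, hr1, ← add_smul, hab]
  have hdisj : Disjoint A B := by
    rw [Set.disjoint_left]
    rintro p ⟨hp1, hp2⟩ ⟨hr1, hr2⟩
    have := hopt p.1 (interior_subset hp1) hr1
    linarith
  obtain ⟨Φ, c, hΦA, hΦB⟩ := geometric_hahn_banach_open hAc hAo hBc hdisj
  set u : E →ₗ[ℝ] ℝ := Φ.toLinearMap ∘ₗ LinearMap.inl ℝ E ℝ with hu
  set α : ℝ := Φ (0, 1) with hα
  have hsplit : ∀ x r, Φ (x, r) = u x + r * α := by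
    intro x r
    have : ((x, r) : E × ℝ) = (x, 0) + r • (0, 1) := by simp
    rw [this, map_add, map_smul]
    simp [hu, hα]
  have hBu : ∀ y, W y = W xs → c ≤ u y := by
    intro y hy
    have := hΦB (y, 0) ⟨hy, rfl⟩
    rw [hsplit] at this
    simpa using this
  have hAu : ∀ x ∈ interior S, ∀ r, f x - f xs < r → u x + r * α < c := by
    intro x hx r hr
    rw [← hsplit]
    exact hΦA _ ⟨hx, hr⟩
  -- The Slater point lies over both sets, so the separating hyperplane cannot be vertical.
  have hαneg : α < 0 := by
    have h1 := hAu x₀ hx₀ (|f x₀ - f xs| + 1) (by linarith [le_abs_self (f x₀ - f xs)])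
    have h2 := hBu x₀ hW
    have h3 : 0 < |f x₀ - f xs| + 1 := by positivity
    by_contra hcon
    have := mul_nonneg h3.le (not_lt.1 hcon)
    linarith
  -- Being bounded below on `xs + ker W`, `u` vanishes on `ker W` and hence factors through `W`.
  have hker : ∀ y, W y = 0 → u y = 0 := by
    intro y hy
    by_contra hne
    have h1 := hBu (xs + ((c - 1 - u xs) / u y) • y) (by simp [hy])
    rw [map_add, map_smul, smul_eq_mul, div_mul_cancel₀ _ hne] at h1
    linarith
  have hmem : u ∈ LinearMap.range W.dualMap := by
    rw [LinearMap.range_dualMap_eq_dualAnnihilator_ker, Submodule.mem_dualAnnihilator]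
    exact fun w hw => hker w hw
  obtain ⟨ψ, hψ⟩ := hmem
  obtain ⟨l, hl⟩ : ∃ l : F, ∀ y, inner ℝ l y = ψ y :=
    ⟨(InnerProductSpace.toDual ℝ F).symm (LinearMap.toContinuousLinearMap ψ), fun y => by simp⟩
  have hul : ∀ x, u x = inner ℝ l (W x) := by
    intro x
    rw [hl, ← hψ]
    rfl
  have hint : ∀ x ∈ interior S, f xs + (-α)⁻¹ * (u x - u xs) ≤ f x := by
    intro x hx
    have h1 : u x + (f x - f xs) * α ≤ u xs := by
      have h2 : ∀ ε > 0, u x + (f x - f xs) * α ≤ u xs + ε := by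
        intro ε hε
        have h3 := hAu x hx (f x - f xs + ε / (-α)) (by
          have : 0 < ε / (-α) := div_pos hε (by linarith)
          linarith)
        have h4 := hBu xs rfl
        have h5 : (f x - f xs + ε / (-α)) * α = (f x - f xs) * α - ε := by
          have := hαneg.ne
          field_simp
          ring
        linarith
      exact le_of_forall_pos_le_add h2
    have h6 : (-α)⁻¹ * (u x - u xs) ≤ f x - f xs := by
      rw [inv_mul_le_iff₀ (by linarith)]
      linarith
    linarith
  refine ⟨(-α)⁻¹ • l, fun x hx => ?_⟩
  have hin : inner ℝ ((-α)⁻¹ • l) (W (x - xs)) = (-α)⁻¹ * (u x - u xs) := by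
    rw [real_inner_smul_left, map_sub, inner_sub_right, ← hul, ← hul]
  rw [hin]
  set β := (-α)⁻¹
  -- The bound passes from the interior to `S` along the segment towards `x₀`; convexity replaces
  -- continuity of `f` at the boundary.
  have hseg : ∀ t ∈ Ioo (0:ℝ) 1, f xs + β * (u x - u xs) +
      t * (β * (u x₀ - u x)) ≤ f x + t * (f x₀ - f x) := by
    intro t ht
    have hm : t • x₀ + (1 - t) • x ∈ interior S :=
      hf.1.combo_interior_self_mem_interior hx₀ hx ht.1 (by linarith [ht.2]) (by ring)
    have h1 := hint _ hm
    have h2 := hf.2 (interior_subset hx₀) hx ht.1.le (by linarith [ht.2]) (by ring : t + (1 - t) = 1)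
    simp only [map_add, map_smul, smul_eq_mul] at h1 h2
    nlinarith
  have hlim : ∀ A B : ℝ, Tendsto (fun t : ℝ => A + t * B) (𝓝[>] 0) (𝓝 A) := by
    intro A B
    have : Continuous fun t : ℝ => A + t * B := by fun_prop
    have h := this.tendsto 0
    simp only [zero_mul, add_zero] at h
    exact h.mono_left nhdsWithin_le_nhds
  refine le_of_tendsto_of_tendsto (hlim _ (β * (u x₀ - u x))) (hlim _ (f x₀ - f x)) ?_
  filter_upwards [Ioo_mem_nhdsGT (zero_lt_one' ℝ)] with t ht
  exact hseg t ht

/-! ### Invariance of closed convex sets -/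

/-- A closed convex set is invariant under a flow whose velocity points into the set. -/
theorem Convex.mem_of_add_deriv_mem {E : Type*} [NormedAddCommGroup E] [NormedSpace ℝ E]
    {Ω : Set E} (hcv : Convex ℝ Ω) (hcl : IsClosed Ω) {y : ℝ → E} {τ : ℝ} (hτ : 0 ≤ τ)
    (hy : AbsolutelyContinuousOnInterval y 0 τ) (h0 : y 0 ∈ Ω)
    (h : ∀ᵐ t, t ∈ Ioo 0 τ → ∃ v, HasDerivAt y v t ∧ y t + v ∈ Ω) : y τ ∈ Ω := by
  by_contra hcon
  obtain ⟨l, c, hlΩ, hlc⟩ := geometric_hahn_banach_closed_point hcv hcl hcon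
  have hly : AbsolutelyContinuousOnInterval (fun t => l (y t) - c) 0 τ := by
    have hlip : LocallyLipschitzOn univ fun x => l x - c :=
      (ContDiff.locallyLipschitz (𝕂 := ℝ) (by fun_prop)).locallyLipschitzOn
    exact hy.comp_locallyLipschitzOn hlip (mapsTo_univ _ _)
  -- Separation gives `(l ∘ y)' ≤ c - l ∘ y`, so the integrating factor `exp` makes `exp t * (l (y
  -- t) - c)` decrease; it could not pass from negative to positive.
  have hexp : AbsolutelyContinuousOnInterval Real.exp 0 τ :=
    Real.contDiff_exp.contDiffOn.absolutelyContinuousOnInterval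
  have hle := (hexp.fun_mul hly).le_of_lower_support hτ (by
    filter_upwards [h] with t ht hm
    obtain ⟨v, hv, hmem⟩ := ht hm
    have hd : HasDerivAt (fun s => l (y s) - c) (l v) t :=
      (l.hasFDerivAt.comp_hasDerivAt t hv).sub_const c
    refine ⟨_, _, (Real.hasDerivAt_exp t).mul hd, rfl, Eventually.of_forall fun _ => le_rfl, ?_⟩
    have h1 := hlΩ _ hmem
    rw [map_add] at h1
    rw [← mul_add]
    exact mul_nonpos_of_nonneg_of_nonpos (Real.exp_pos t).le (by linarith))
  have h1 := hlΩ _ h0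
  have h2 : 0 < Real.exp τ * (l (y τ) - c) := mul_pos (Real.exp_pos τ) (by linarith)
  have h3 : Real.exp 0 * (l (y 0) - c) < 0 :=
    mul_neg_of_pos_of_neg (Real.exp_pos 0) (by linarith)
  linarith

end Analysis

namespace EMO

/-! ### Clarke gradients and projections -/

/-- On an open set where `f` is convex, Clarke generalized gradients are subgradients. -/
theorem clarkeGradient_subgradient {k : ℕ} {f : Vec k → ℝ} {U : Set (Vec k)} (hU : IsOpen U)
    (hf : ConvexOn ℝ U f) {x y g : Vec k} (hx : x ∈ U) (hy : y ∈ U)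
    (hg : g ∈ clarkeGradient f x) : f x + inner ℝ g (y - x) ≤ f y := by
  have hcont := hf.continuousOn hU
  have h1 := hg (y - x)
  have hlim : Tendsto (fun s : Vec k × ℝ => ((f (s.1 + (y - x)) - f s.1 : ℝ) : EReal))
      (𝓝 x ×ˢ 𝓝[>] (0 : ℝ)) (𝓝 ((f y - f x : ℝ) : EReal)) := by
    refine (continuous_coe_real_ereal.tendsto _).comp (Tendsto.sub ?_ ?_)
    · have h2 : Tendsto (fun s : Vec k × ℝ => s.1 + (y - x)) (𝓝 x ×ˢ 𝓝[>] (0 : ℝ)) (𝓝 y) := by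
        have : Tendsto (fun s : Vec k × ℝ => s.1 + (y - x)) (𝓝 x ×ˢ 𝓝[>] (0 : ℝ))
          (𝓝 (x + (y - x))) := tendsto_fst.add_const _
        simpa using this
      exact (hcont.continuousAt (hU.mem_nhds hy)).tendsto.comp h2
    · exact (hcont.continuousAt (hU.mem_nhds hx)).tendsto.comp tendsto_fst
  have hU1 : ∀ᶠ s : Vec k × ℝ in 𝓝 x ×ˢ 𝓝[>] (0 : ℝ), s.1 ∈ U :=
    tendsto_fst.eventually (hU.mem_nhds hx)
  have hU2 : ∀ᶠ s : Vec k × ℝ in 𝓝 x ×ˢ 𝓝[>] (0 : ℝ), s.1 + (y - x) ∈ U := by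
    have : Tendsto (fun s : Vec k × ℝ => s.1 + (y - x)) (𝓝 x ×ˢ 𝓝[>] (0 : ℝ))
      (𝓝 (x + (y - x))) := tendsto_fst.add_const _
    refine this.eventually (hU.mem_nhds ?_)
    simpa using hy
  have hU3 : ∀ᶠ s : Vec k × ℝ in 𝓝 x ×ˢ 𝓝[>] (0 : ℝ), s.2 ∈ Ioo (0 : ℝ) 1 :=
    tendsto_snd.eventually (Ioo_mem_nhdsGT (zero_lt_one' ℝ))
  -- By convexity each difference quotient with step below `1` is at most the one with step `1`,
  -- which is continuous in the base point.
  have hle : clarkeDeriv f x (y - x) ≤ ((f y - f x : ℝ) : EReal) := by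
    rw [← hlim.limsup_eq]
    refine limsup_le_limsup ?_
    filter_upwards [hU1, hU2, hU3] with s hs1 hs2 hs3
    rw [EReal.coe_le_coe_iff, div_le_iff₀ hs3.1]
    have h3 := hf.2 hs1 hs2 (by linarith [hs3.2] : 0 ≤ 1 - s.2) hs3.1.le (by ring)
    have h4 : (1 - s.2) • s.1 + s.2 • (s.1 + (y - x)) = s.1 + s.2 • (y - x) := by module
    rw [h4] at h3
    simp only [smul_eq_mul] at h3
    linarith
  have h5 := EReal.coe_le_coe_iff.1 (h1.trans hle)
  linarith

/-- The variational inequality that characterizes the projection. -/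
theorem inner_sub_proj_nonpos {k : ℕ} {Ω : Set (Vec k)} (hne : Ω.Nonempty) (hcl : IsClosed Ω)
    (hcv : Convex ℝ Ω) (u : Vec k) {w : Vec k} (hw : w ∈ Ω) :
    inner ℝ (u - proj Ω u) (w - proj Ω u) ≤ 0 := by
  have hp := (eq_proj_iff hne hcl hcv u _).1 rfl
  have : Nonempty Ω := hne.to_subtype
  refine (norm_eq_iInf_iff_real_inner_le_zero hcv hp.1).1 ?_ w hw
  refine le_antisymm (le_ciInf fun y => hp.2 y y.2) ?_
  exact ciInf_le ⟨0, forall_mem_range.2 fun _ => norm_nonneg _⟩ (⟨_, hp.1⟩ : Ω)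

theorem proj_mem {k : ℕ} {Ω : Set (Vec k)} (hne : Ω.Nonempty) (hcl : IsClosed Ω)
    (hcv : Convex ℝ Ω) (u : Vec k) : proj Ω u ∈ Ω :=
  ((eq_proj_iff hne hcl hcv u _).1 rfl).1

/-! ### The graph Laplacian -/

namespace WeightedGraph

variable {n m : ℕ} (G : WeightedGraph n)

/-- The bilinear form of the graph Laplacian. -/
theorem sum_inner_lap (w μ : Fin n → Vec m) :
    ∑ i, inner ℝ (w i) (G.lap μ i) =
      2⁻¹ * ∑ i, ∑ j, G.a i j * inner ℝ (w i - w j) (μ i - μ j) := by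
  have h1 : ∑ i, inner ℝ (w i) (G.lap μ i) = ∑ i, ∑ j, G.a i j * inner ℝ (w i) (μ i - μ j) := by
    simp only [lap, inner_sum, real_inner_smul_right]
  have h2 : ∑ i, ∑ j, G.a i j * inner ℝ (w i) (μ i - μ j) =
      ∑ i, ∑ j, G.a i j * inner ℝ (- w j) (μ i - μ j) := by
    rw [Finset.sum_comm]
    refine Finset.sum_congr rfl fun i _ => Finset.sum_congr rfl fun j _ => ?_
    rw [G.symm j i, ← neg_sub (μ i), inner_neg_right, inner_neg_left]
  have h3 : ∑ i, ∑ j, G.a i j * inner ℝ (w i - w j) (μ i - μ j) =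
      ∑ i, ∑ j, G.a i j * inner ℝ (w i) (μ i - μ j) +
      ∑ i, ∑ j, G.a i j * inner ℝ (- w j) (μ i - μ j) := by
    simp only [← Finset.sum_add_distrib, ← mul_add, ← inner_add_left, sub_eq_add_neg]
  rw [h1, h3, ← h2]
  ring

theorem sum_inner_lap_comm (w μ : Fin n → Vec m) :
    ∑ i, inner ℝ (w i) (G.lap μ i) = ∑ i, inner ℝ (μ i) (G.lap w i) := by
  rw [sum_inner_lap, sum_inner_lap]
  simp only [real_inner_comm]

theorem sum_inner_lap_self_nonneg (μ : Fin n → Vec m) : 0 ≤ ∑ i, inner ℝ (μ i) (G.lap μ i) := by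
  rw [sum_inner_lap]
  refine mul_nonneg (by norm_num) (Finset.sum_nonneg fun i _ => Finset.sum_nonneg fun j _ => ?_)
  exact mul_nonneg (G.nonneg i j) real_inner_self_nonneg

theorem lap_sub (μ ν : Fin n → Vec m) (i : Fin n) :
    G.lap (fun j => μ j - ν j) i = G.lap μ i - G.lap ν i := by
  simp only [lap, ← Finset.sum_sub_distrib, ← smul_sub]
  refine Finset.sum_congr rfl fun j _ => ?_
  congr 1
  abel

theorem lap_sub_const (μ : Fin n → Vec m) (c : Vec m) (i : Fin n) :
    G.lap (fun j => μ j - c) i = G.lap μ i := by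
  simp [lap]

/-- The graph Laplacian as a linear map. -/
def lapLin : (Fin n → Vec m) →ₗ[ℝ] (Fin n → Vec m) where
  toFun := G.lap
  map_add' μ ν := by
    ext1 i
    simp only [lap, Pi.add_apply, ← Finset.sum_add_distrib, ← smul_add]
    refine Finset.sum_congr rfl fun j _ => ?_
    congr 1
    abel
  map_smul' c μ := by
    ext1 i
    simp only [lap, Pi.smul_apply, ← smul_sub, Finset.smul_sum, RingHom.id_apply]
    refine Finset.sum_congr rfl fun j _ => smul_comm _ _ _

variable {G}

/-- The energy is half the sum of the terms `a i j * ‖μ i - μ j‖²`; if it is zero, `μ` is constant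
along every edge, hence along every path. -/
theorem eq_of_sum_inner_lap_self_eq_zero (hG : G.Connected) {μ : Fin n → Vec m}
    (h : ∑ i, inner ℝ (μ i) (G.lap μ i) = 0) (i j : Fin n) : μ i = μ j := by
  rw [sum_inner_lap] at h
  have hnn : ∀ i j, 0 ≤ G.a i j * inner ℝ (μ i - μ j) (μ i - μ j) := fun i j =>
    mul_nonneg (G.nonneg i j) real_inner_self_nonneg
  have h0 : ∑ i, ∑ j, G.a i j * inner ℝ (μ i - μ j) (μ i - μ j) = 0 := by linarith
  have h1 : ∀ i j, G.a i j * inner ℝ (μ i - μ j) (μ i - μ j) = 0 := by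
    intro i j
    have h2 := (Finset.sum_eq_zero_iff_of_nonneg
      (fun i _ => Finset.sum_nonneg fun j _ => hnn i j)).1 h0 i (Finset.mem_univ i)
    exact (Finset.sum_eq_zero_iff_of_nonneg (fun j _ => hnn i j)).1 h2 j (Finset.mem_univ j)
  have hpos : ∀ i j, 0 < G.a i j → μ i = μ j := by
    intro i j hij
    have := (mul_eq_zero.1 (h1 i j)).resolve_left hij.ne'
    exact sub_eq_zero.1 (inner_self_eq_zero.1 this)
  have hadj : ∀ i j, (SimpleGraph.fromRel fun i j => 0 < G.a i j).Adj i j → μ i = μ j := by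
    intro i j hij
    rw [SimpleGraph.fromRel_adj] at hij
    exact hij.2.elim (hpos i j) fun h => (hpos j i h).symm
  obtain ⟨p⟩ := hG.preconnected i j
  induction p with
  | nil => rfl
  | cons h _ ih => exact (hadj _ _ h).trans ih

/-- On a connected graph the range of the Laplacian consists of the vectors of zero sum. -/
theorem exists_lap_eq (hG : G.Connected) {b : Fin n → Vec m} (hb : ∑ i, b i = 0) :
    ∃ z, ∀ i, G.lap z i = b i := by
  suffices b ∈ LinearMap.range (G.lapLin (m := m)) by
    obtain ⟨z, hz⟩ := this
    exact ⟨z, fun i => congrFun hz i⟩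
  by_contra hcon
  obtain ⟨ψ, hψb, hψ⟩ := Submodule.exists_le_ker_of_notMem hcon
  obtain ⟨w, hw⟩ : ∃ w : Fin n → Vec m, ∀ v, ψ v = ∑ i, inner ℝ (w i) (v i) := by
    refine ⟨fun i => (InnerProductSpace.toDual ℝ (Vec m)).symm
      (LinearMap.toContinuousLinearMap (ψ ∘ₗ LinearMap.single ℝ (fun _ => Vec m) i)), fun v => ?_⟩
    simp only [InnerProductSpace.toDual_symm_apply, LinearMap.coe_toContinuousLinearMap',
      LinearMap.comp_apply, LinearMap.coe_single, ← map_sum]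
    rw [Finset.univ_sum_single]
  -- Testing `ψ`, which kills the range, on `L w` itself shows that `w` is constant; then `ψ b` is
  -- the pairing of that constant with `∑ b i = 0`.
  have h0 : ∑ i, inner ℝ (w i) (G.lap w i) = 0 := by
    rw [← hw]
    exact hψ ⟨w, rfl⟩
  refine hψb ?_
  obtain ⟨i₀⟩ := hG.nonempty
  rw [hw, Finset.sum_congr rfl fun i _ => by
    rw [eq_of_sum_inner_lap_self_eq_zero hG h0 i i₀], ← inner_sum, hb, inner_zero_right]

end WeightedGraph

variable {n m : ℕ} {q : Fin n → ℕ} (P : Problem n m q)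

namespace Problem

theorem applyWT_sub (i : Fin n) (x y : Vec m) :
    P.applyWT i (x - y) = P.applyWT i x - P.applyWT i y := map_sub _ _ _

theorem inner_applyWT (i : Fin n) (l : Vec m) (x : Vec (q i)) :
    inner ℝ (P.applyWT i l) x = inner ℝ l (P.applyW i x) := by
  have h : (P.W i).transpose = (P.W i).conjTranspose := by
    rw [Matrix.conjTranspose_eq_transpose_of_trivial]
  rw [applyWT, applyW, h, Matrix.toEuclideanLin_conjTranspose_eq_adjoint,
    LinearMap.adjoint_inner_left]

/-- The linear map `x ↦ ∑ᵢ Wᵢ xᵢ`. -/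
noncomputable def sumW : ((i : Fin n) → Vec (q i)) →ₗ[ℝ] Vec m :=
  ∑ i, (P.W i).toEuclideanLin ∘ₗ LinearMap.proj i

theorem sumW_apply (x : (i : Fin n) → Vec (q i)) : P.sumW x = ∑ i, P.applyW i (x i) := by
  simp [sumW, applyW]

end Problem

end EMO

/-! ### Dissipation inequalities and Barbalat's lemma -/

section Dissipation

variable {u h : ℝ → ℝ}

/-- A dissipation inequality, in the sense of lower supports, makes the storage decrease. -/
theorem antitoneOn_of_lower_support
    (hu : ∀ a b, 0 ≤ a → a ≤ b → AbsolutelyContinuousOnInterval u a b)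
    (hsu : ∀ᵐ t, 0 < t → ∃ k κ, HasDerivAt k κ t ∧ k t = u t ∧ (∀ᶠ s in 𝓝 t, k s ≤ u s) ∧ κ ≤ 0) :
    AntitoneOn u (Ici 0) := by
  intro a ha b _ hab
  refine (hu a b ha hab).le_of_lower_support hab ?_
  filter_upwards [hsu] with t ht hm
  exact ht (lt_of_le_of_lt ha hm.1)

/-- A one-sided form of Barbalat's lemma: a nonnegative dissipation rate whose growth is bounded
tends to zero. -/
theorem tendsto_zero_of_dissipation {C : ℝ} (hC : 0 ≤ C)
    (hu : ∀ a b, 0 ≤ a → a ≤ b → AbsolutelyContinuousOnInterval u a b)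
    (hh : ∀ a b, 0 ≤ a → a ≤ b → AbsolutelyContinuousOnInterval h a b)
    (hu0 : ∀ t, 0 ≤ t → 0 ≤ u t) (hh0 : ∀ t, 0 ≤ t → 0 ≤ h t)
    (hsu : ∀ᵐ t, 0 < t →
      ∃ k κ, HasDerivAt k κ t ∧ k t = u t ∧ (∀ᶠ s in 𝓝 t, k s ≤ u s) ∧ κ ≤ -h t)
    (hsh : ∀ᵐ t, 0 < t →
      ∃ k κ, HasDerivAt k κ t ∧ k t = h t ∧ (∀ᶠ s in 𝓝 t, k s ≤ h s) ∧ κ ≤ C) :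
    Tendsto h atTop (𝓝 0) := by
  have hpoly : ∀ {p : ℝ → ℝ} (a b : ℝ), ContDiff ℝ 1 p → AbsolutelyContinuousOnInterval p a b :=
    fun a b hp => hp.contDiffOn.absolutelyContinuousOnInterval
  have hgrow : ∀ s t, 0 ≤ s → s ≤ t → h t ≤ h s + C * (t - s) := by
    intro s t hs hst
    have hac : AbsolutelyContinuousOnInterval (fun r => h r - C * r) s t :=
      (hh s t hs hst).fun_sub (hpoly s t (by fun_prop))
    have := hac.le_of_lower_support hst (by
      filter_upwards [hsh] with r hr hm
      obtain ⟨k, κ, h1, h2, h3, h4⟩ := hr (lt_of_le_of_lt hs hm.1)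
      refine ⟨_, _, h1.sub ((hasDerivAt_id r).const_mul C), by simp [h2], ?_, by linarith⟩
      filter_upwards [h3] with y hy
      simpa using hy)
    linarith
  -- On `[t - δ, t]` the growth bound gives `h s ≥ h t - C * (t - s)`; integrated, this is the least
  -- loss of `u`.
  have hstep : ∀ δ t, 0 ≤ δ → δ ≤ t → h t * δ ≤ u (t - δ) - u t + C * δ ^ 2 / 2 := by
    intro δ t hδ hδt
    have hac : AbsolutelyContinuousOnInterval
        (fun s => u s + (h t * s + C * (t - s) ^ 2 / 2)) (t - δ) t :=
      (hu _ _ (by linarith) (by linarith)).fun_add (hpoly _ _ (by fun_prop))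
    have := hac.le_of_lower_support (by linarith) (by
      filter_upwards [hsu] with r hr hm
      have hr0 : 0 < r := by linarith [hm.1]
      obtain ⟨k, κ, h1, h2, h3, h4⟩ := hr hr0
      have hd : HasDerivAt (fun s => h t * s + C * (t - s) ^ 2 / 2) (h t - C * (t - r)) r := by
        have e1 := (hasDerivAt_id r).const_mul (h t)
        have e2 := ((((hasDerivAt_id r).const_sub t).pow 2).const_mul C).div_const 2
        refine (e1.add e2).congr_deriv ?_
        simp only [id_eq]
        ring
      refine ⟨_, _, h1.add hd, by simp [h2], ?_, ?_⟩
      · filter_upwards [h3] with y hy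
        simpa using hy
      · linarith [hgrow r t hr0.le hm.2.le])
    simp only [sub_self, sub_sub_cancel] at this
    linarith
  have hanti : AntitoneOn u (Ici 0) := by
    refine antitoneOn_of_lower_support hu ?_
    filter_upwards [hsu] with t ht h0
    obtain ⟨k, κ, h1, h2, h3, h4⟩ := ht h0
    exact ⟨k, κ, h1, h2, h3, h4.trans (by linarith [hh0 t h0.le])⟩
  obtain ⟨L, hL⟩ : ∃ L, Tendsto u atTop (𝓝 L) := by
    have hv : Antitone fun t => u (max t 0) := fun a b hab =>
      hanti (mem_Ici.2 (le_max_right _ _)) (mem_Ici.2 (le_max_right _ _)) (max_le_max_right 0 hab)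
    have hb : BddBelow (range fun t => u (max t 0)) :=
      ⟨0, forall_mem_range.2 fun t => hu0 _ (le_max_right _ _)⟩
    refine ⟨_, (tendsto_atTop_ciInf hv hb).congr' ?_⟩
    filter_upwards [eventually_ge_atTop 0] with t ht
    rw [max_eq_left ht]
  rw [Metric.tendsto_atTop']
  intro ε hε
  -- With this `δ` the quadratic error is at most `ε * δ / 2`; the drop of `u` over a window of
  -- length `δ` is eventually below the other half.
  set δ := ε / (C + 1) with hδ
  have hδ0 : 0 < δ := by positivity
  have hδC : C * δ ≤ ε := by
    rw [hδ, ← mul_div_assoc, div_le_iff₀ (by positivity)]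
    nlinarith
  have hlim : Tendsto (fun t => u (t - δ) - u t) atTop (𝓝 (L - L)) :=
    (hL.comp (tendsto_atTop_add_const_right _ (-δ) tendsto_id)).sub hL
  rw [sub_self] at hlim
  have hev : ∀ᶠ t in atTop, dist (h t) 0 < ε := by
    filter_upwards [hlim.eventually_lt_const (by positivity : 0 < ε * δ / 2),
      eventually_ge_atTop δ] with t ht1 ht2
    have h1 := hstep δ t hδ0.le ht2
    rw [Real.dist_eq, sub_zero, abs_of_nonneg (hh0 t (hδ0.le.trans ht2))]
    have h2 : h t * δ < ε * δ := by nlinarith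
    exact lt_of_mul_lt_mul_right h2 hδ0.le
  obtain ⟨N, hN⟩ := eventually_atTop.1 hev
  exact ⟨N, fun t ht => hN t ht.le⟩

/-- In a compact set, a curve along which a continuous function that is positive off `xs` tends to
zero converges to `xs`. -/
theorem IsCompact.tendsto_of_tendsto_zero {X ι : Type*} [TopologicalSpace X] {K : Set X}
    (hK : IsCompact K) {D : X → ℝ} (hD : ContinuousOn D K) {xs : X}
    (hpos : ∀ x ∈ K, x ≠ xs → 0 < D x) {l : Filter ι} {x : ι → X} (hx : ∀ᶠ t in l, x t ∈ K)
    (hlim : Tendsto (fun t => D (x t)) l (𝓝 0)) : Tendsto x l (𝓝 xs) := by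
  refine tendsto_nhds.2 fun N hN hxs => ?_
  have hc : IsCompact (K \ N) := hK.diff hN
  rcases (K \ N).eq_empty_or_nonempty with he | hne
  · filter_upwards [hx] with t ht
    exact sdiff_eq_empty.1 he ht
  · obtain ⟨y, hy, hmin⟩ := hc.exists_isMinOn hne (hD.mono sdiff_subset)
    have hy0 : 0 < D y := hpos y hy.1 fun h => hy.2 (h ▸ hxs)
    filter_upwards [hx, hlim.eventually_lt_const hy0] with t ht1 ht2
    by_contra hcon
    exact absurd (hmin ⟨ht1, hcon⟩) (not_le.2 ht2)

end Dissipation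

/-! ### The duality gap -/

namespace EMO

variable {n m : ℕ} {q : Fin n → ℕ}

namespace Problem

variable (P : Problem n m q)

/-- The duality gap `f(x) - f(xs) - ⟨l, W (x - xs)⟩`. -/
noncomputable def gap (l : Vec m) (xs x : (i : Fin n) → Vec (q i)) : ℝ :=
  P.objective x - P.objective xs - inner ℝ l (P.sumW (x - xs))

theorem gap_self (l : Vec m) (xs : (i : Fin n) → Vec (q i)) : P.gap l xs xs = 0 := by
  simp [gap]

variable {P}

theorem strictConvexOn_objective {U : (i : Fin n) → Set (Vec (q i))}
    (hU : ∀ i, StrictConvexOn ℝ (U i) (P.f i)) : StrictConvexOn ℝ (pi univ U) P.objective := by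
  refine ⟨convex_pi fun i _ => (hU i).1, fun x hx y hy hxy a b ha hb hab => ?_⟩
  obtain ⟨j, hj⟩ := Function.ne_iff.1 hxy
  simp only [objective, smul_eq_mul, Finset.mul_sum, ← Finset.sum_add_distrib]
  refine Finset.sum_lt_sum (fun i hi => ?_) ⟨j, Finset.mem_univ j, ?_⟩
  · exact (hU i).convexOn.2 (hx i trivial) (hy i trivial) ha.le hb.le hab
  · exact (hU j).2 (hx j trivial) (hy j trivial) hj ha hb hab

theorem strictConvexOn_gap {U : (i : Fin n) → Set (Vec (q i))}
    (hU : ∀ i, StrictConvexOn ℝ (U i) (P.f i)) (l : Vec m) (xs : (i : Fin n) → Vec (q i)) :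
    StrictConvexOn ℝ (pi univ U) (P.gap l xs) := by
  have h1 := strictConvexOn_objective hU
  have h2 : ConvexOn ℝ (pi univ U) fun x => -P.objective xs - inner ℝ l (P.sumW (x - xs)) := by
    refine ⟨h1.1, fun x _ y _ a b _ _ hab => le_of_eq ?_⟩
    obtain rfl : b = 1 - a := by linarith
    simp only [map_sub, map_add, map_smul, inner_sub_right, inner_add_right,
      real_inner_smul_right, smul_eq_mul]
    ring
  have h3 : P.gap l xs =
      P.objective + fun x => -P.objective xs - inner ℝ l (P.sumW (x - xs)) := by
    ext x
    simp only [gap, Pi.add_apply]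
    ring
  rw [h3]
  exact h1.add_convexOn h2

/-- The multiplier term is affine, so `g - Wᵀ l` is a subgradient of the gap whenever `g` is one of
the objective. -/
theorem gap_subgradient {U : (i : Fin n) → Set (Vec (q i))} (hUo : ∀ i, IsOpen (U i))
    (hU : ∀ i, ConvexOn ℝ (U i) (P.f i)) (l : Vec m) {xs x y g : (i : Fin n) → Vec (q i)}
    (hx : ∀ i, x i ∈ U i) (hy : ∀ i, y i ∈ U i) (hg : ∀ i, g i ∈ clarkeGradient (P.f i) (x i)) :
    P.gap l xs x + ∑ i, inner ℝ (g i - P.applyWT i l) (y i - x i) ≤ P.gap l xs y := by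
  have h1 : P.objective x + ∑ i, inner ℝ (g i) (y i - x i) ≤ P.objective y := by
    simp only [objective, ← Finset.sum_add_distrib]
    exact Finset.sum_le_sum fun i _ =>
      clarkeGradient_subgradient (hUo i) (hU i) (hx i) (hy i) (hg i)
  have h2 : ∑ i, inner ℝ (g i - P.applyWT i l) (y i - x i) =
      ∑ i, inner ℝ (g i) (y i - x i) - inner ℝ l (P.sumW (y - x)) := by
    simp only [sumW_apply, inner_sum, ← Finset.sum_sub_distrib, inner_sub_left, inner_applyWT,
      Pi.sub_apply]
  have h3 : P.sumW (y - x) = P.sumW (y - xs) - P.sumW (x - xs) := by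
    rw [← map_sub]
    congr 1
    abel
  rw [h2, h3, inner_sub_right]
  simp only [gap]
  linarith

end Problem

variable {G : WeightedGraph n} {P : Problem n m q}

namespace StandingAssumption

theorem nonempty (hA : StandingAssumption G P) (i : Fin n) : (P.Ω i).Nonempty := by
  obtain ⟨x, hx, _⟩ := hA.slater
  exact ⟨x i, interior_subset hx i trivial⟩

theorem exists_multiplier (hA : StandingAssumption G P) {xs : (i : Fin n) → Vec (q i)}
    (hxs : P.IsOptimal xs) : ∃ l, ∀ x ∈ P.feasibleBox, 0 ≤ P.gap l xs x := by
  choose U hUo hΩU hU using hA.strictConvex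
  obtain ⟨x₀, hx₀, hW⟩ := hA.slater
  have hf : ConvexOn ℝ P.feasibleBox P.objective :=
    (Problem.strictConvexOn_objective hU).convexOn.subset (pi_mono fun i _ => hΩU i)
      (convex_pi fun i _ => hA.convex i)
  have hsum : ∀ x, P.EqConstraint x ↔ P.sumW x = P.sumW xs := by
    intro x
    rw [P.sumW_apply xs, hxs.2.1, P.sumW_apply]
    rfl
  obtain ⟨l, hl⟩ := exists_lagrange_multiplier hf P.sumW hx₀ ((hsum x₀).1 hW)
    fun y hy hyW => hxs.2.2 y hy ((hsum y).2 hyW)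
  refine ⟨l, fun x hx => ?_⟩
  have := hl x hx
  simp only [Problem.gap]
  linarith

/-- At the midpoint of `x` and `xs` strict convexity puts the gap strictly below half the gap at
`x`, yet the gap is nonnegative there. -/
theorem gap_pos (hA : StandingAssumption G P) {l : Vec m} {xs : (i : Fin n) → Vec (q i)}
    (hxs : xs ∈ P.feasibleBox) (hl : ∀ x ∈ P.feasibleBox, 0 ≤ P.gap l xs x)
    {x : (i : Fin n) → Vec (q i)} (hx : x ∈ P.feasibleBox) (hne : x ≠ xs) : 0 < P.gap l xs x := by
  choose U hUo hΩU hU using hA.strictConvex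
  have hmono : P.feasibleBox ⊆ pi univ U := pi_mono fun i _ => hΩU i
  have h1 := (Problem.strictConvexOn_gap hU l xs).2 (hmono hx) (hmono hxs) hne
    (by norm_num : (0 : ℝ) < 2⁻¹) (by norm_num : (0 : ℝ) < 2⁻¹) (by norm_num)
  have h2 := hl _ ((convex_pi fun i _ => hA.convex i : Convex ℝ P.feasibleBox) hx hxs
    (by norm_num : (0 : ℝ) ≤ 2⁻¹) (by norm_num : (0 : ℝ) ≤ 2⁻¹) (by norm_num))
  rw [P.gap_self, smul_zero, add_zero, smul_eq_mul] at h1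
  linarith

/-- Convexity on an open set around the box gives the Lipschitz bound up to the boundary of the box,
so the gap is absolutely continuous along solutions. -/
theorem locallyLipschitzOn_gap (hA : StandingAssumption G P) (l : Vec m)
    (xs : (i : Fin n) → Vec (q i)) : LocallyLipschitzOn P.feasibleBox (P.gap l xs) := by
  choose U hUo hΩU hU using hA.strictConvex
  have h := (Problem.strictConvexOn_gap hU l xs).convexOn.locallyLipschitzOn
    (isOpen_set_pi finite_univ fun i _ => hUo i)
  exact h.mono (pi_mono fun i _ => hΩU i)

/-- Between two points satisfying the equality constraint the multiplier term vanishes, and the gap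
is the difference of the objective values. -/
theorem unique_optimal (hA : StandingAssumption G P) {xs y : (i : Fin n) → Vec (q i)}
    (hxs : P.IsOptimal xs) (hy : P.IsOptimal y) : y = xs := by
  obtain ⟨l, hl⟩ := hA.exists_multiplier hxs
  by_contra hne
  have h1 := hA.gap_pos hxs.1 hl hy.1 hne
  have h2 : P.sumW (y - xs) = 0 := by
    rw [map_sub, P.sumW_apply, P.sumW_apply, hxs.2.1, hy.2.1, sub_self]
  have h3 := hy.2.2 xs hxs.1 hxs.2.1
  simp only [Problem.gap, h2, inner_zero_right] at h1
  linarith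

/-! ### Lyapunov estimates -/

/-- The dissipation inequality for the Lyapunov function. -/
theorem dissipation (hA : StandingAssumption G P) {d : Fin n → Vec m} {s v : State n m q}
    {g xs : (i : Fin n) → Vec (q i)} {zs : Fin n → Vec m} (l : Vec m)
    (hxs : xs ∈ P.feasibleBox) (hzs : ∀ i, G.lap zs i = d i - P.applyW i (xs i))
    (hs : s.1 ∈ P.feasibleBox) (hg : ∀ i, g i ∈ clarkeGradient (P.f i) (s.1 i))
    (hp : ∀ i, v.1 i = proj (P.Ω i) (s.1 i - g i + P.applyWT i (s.2.1 i)) - s.1 i)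
    (hμ : ∀ i, v.2.1 i = d i - P.applyW i (s.1 i) - G.lap s.2.1 i - G.lap s.2.2 i
      - P.applyW i (v.1 i))
    (hζ : ∀ i, v.2.2 i = G.lap s.2.1 i) :
    ∑ i, inner ℝ (g i - P.applyWT i l) (v.1 i) + (∑ i, inner ℝ (s.1 i - xs i) (v.1 i) +
      ∑ i, inner ℝ (s.2.1 i - l) (v.2.1 i) + ∑ i, inner ℝ (s.2.2 i - zs i) (v.2.2 i)) ≤
      -P.gap l xs s.1 := by
  choose U hUo hΩU hU using hA.strictConvex
  -- The projection inequality is tested at `xs i`. The term `⟨λ - l, W p⟩` it leaves is cancelled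
  -- by the feedback `-W p` in the `λ`-equation, and `-‖p‖²` is dropped.
  have hterm : ∀ i, inner ℝ (g i - P.applyWT i l) (v.1 i) + (inner ℝ (s.1 i - xs i) (v.1 i) +
      inner ℝ (s.2.1 i - l) (v.2.1 i) + inner ℝ (s.2.2 i - zs i) (v.2.2 i)) ≤
      inner ℝ (g i - P.applyWT i l) (xs i - s.1 i) - inner ℝ (s.2.1 i - l) (G.lap s.2.1 i) -
      inner ℝ (s.2.1 i - l) (G.lap s.2.2 i - G.lap zs i) +
      inner ℝ (s.2.2 i - zs i) (G.lap s.2.1 i) := by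
    intro i
    have hvi := inner_sub_proj_nonpos (hA.nonempty i) (hA.closed i) (hA.convex i)
      (s.1 i - g i + P.applyWT i (s.2.1 i)) (hxs i trivial)
    have hq : proj (P.Ω i) (s.1 i - g i + P.applyWT i (s.2.1 i)) = s.1 i + v.1 i := by
      rw [hp i]
      abel
    have hd : d i = G.lap zs i + P.applyW i (xs i) := by
      rw [hzs i]
      abel
    have hpp := real_inner_self_nonneg (x := v.1 i)
    rw [hq] at hvi
    rw [hμ i, hζ i, hd]
    simp only [inner_sub_left, inner_sub_right, inner_add_left, inner_add_right,
      P.inner_applyWT] at hvi ⊢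
    linarith [real_inner_comm (v.1 i) (xs i), real_inner_comm (v.1 i) (s.1 i)]
  have hsum := Finset.sum_le_sum fun i (_ : i ∈ Finset.univ) => hterm i
  simp only [Finset.sum_add_distrib, Finset.sum_sub_distrib] at hsum
  have h1 := Problem.gap_subgradient hUo (fun i => (hU i).convexOn) l (xs := xs)
    (fun i => hΩU i (hs i trivial)) (fun i => hΩU i (hxs i trivial)) hg
  rw [P.gap_self] at h1
  -- The `λ`-energy has the right sign, and the coupling of `λ` with `z` cancels by symmetry of the
  -- Laplacian.
  have h2 := G.sum_inner_lap_self_nonneg fun i => s.2.1 i - l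
  have h3 := G.sum_inner_lap_comm (fun i => s.2.1 i - l) fun i => s.2.2 i - zs i
  simp only [G.lap_sub_const] at h2 h3
  simp only [G.lap_sub] at h3
  linarith

/-- The duality gap grows at a rate that is controlled by the multipliers alone. -/
theorem gap_rate_le (hA : StandingAssumption G P) {s v : State n m q}
    {g : (i : Fin n) → Vec (q i)} (l : Vec m) (hs : s.1 ∈ P.feasibleBox)
    (hp : ∀ i, v.1 i = proj (P.Ω i) (s.1 i - g i + P.applyWT i (s.2.1 i)) - s.1 i) :
    ∑ i, inner ℝ (g i - P.applyWT i l) (v.1 i) ≤ ∑ i, ‖P.applyWT i (s.2.1 i - l)‖ ^ 2 := by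
  refine Finset.sum_le_sum fun i _ => ?_
  -- Testing at the current point gives `⟨g - Wᵀ λ, p⟩ ≤ -‖p‖²`. This eliminates `g`, and `-‖p‖²`
  -- absorbs the remaining `⟨Wᵀ(λ - l), p⟩`.
  have hvi := inner_sub_proj_nonpos (hA.nonempty i) (hA.closed i) (hA.convex i)
    (s.1 i - g i + P.applyWT i (s.2.1 i)) (hs i trivial)
  have hq : proj (P.Ω i) (s.1 i - g i + P.applyWT i (s.2.1 i)) = s.1 i + v.1 i := by
    rw [hp i]
    abel
  rw [hq, sub_add_cancel_left, inner_neg_right] at hvi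
  have h1 : inner ℝ (g i - P.applyWT i l) (v.1 i) ≤
      inner ℝ (P.applyWT i (s.2.1 i - l)) (v.1 i) - inner ℝ (v.1 i) (v.1 i) := by
    rw [P.applyWT_sub]
    simp only [inner_sub_left, inner_add_left] at hvi ⊢
    linarith
  have h2 := real_inner_le_norm (P.applyWT i (s.2.1 i - l)) (v.1 i)
  rw [real_inner_self_eq_norm_sq] at h1
  nlinarith [sq_nonneg (‖P.applyWT i (s.2.1 i - l)‖ - ‖v.1 i‖),
    sq_nonneg ‖P.applyWT i (s.2.1 i - l)‖, sq_nonneg ‖v.1 i‖]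

end StandingAssumption

end EMO

/-! ### Solutions of the algorithm -/

namespace EMO

variable {n m : ℕ} {q : Fin n → ℕ} {G : WeightedGraph n} {P : Problem n m q}
  {d : Fin n → Vec m} {φ : ℝ → State n m q}

theorem IsSolution.absolutelyContinuous {S : Type*} [NormedAddCommGroup S] [NormedSpace ℝ S]
    {F : S → Set S} {φ : ℝ → S} (h : IsSolution F φ) {a b : ℝ} (ha : 0 ≤ a) (hab : a ≤ b) :
    AbsolutelyContinuousOnInterval φ a b := by
  -- `b` may be `0`, whereas `IsSolution` speaks of `τ > 0` only.
  refine (h.1 (b + 1) (by linarith)).mono ?_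
  rw [uIcc_of_le hab, uIcc_of_le (by linarith)]
  exact Icc_subset_Icc ha (by linarith)

theorem IsSolution.ae_hasDerivAt {S : Type*} [NormedAddCommGroup S] [NormedSpace ℝ S]
    {F : S → Set S} {φ : ℝ → S} (h : IsSolution F φ) :
    ∀ᵐ t, 0 < t → ∃ v ∈ F (φ t), HasDerivAt φ v t := by
  filter_upwards [(ae_restrict_iff' measurableSet_Ici).1 h.2] with t ht h0
  exact ht (mem_Ici.2 h0.le)

/-- Position plus velocity is a projection onto `Ω i`, so the velocity points into the set. -/
theorem StandingAssumption.mem_feasibleBox (hA : StandingAssumption G P)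
    (hφ : IsSolution (ddfa G P d) φ) (h0 : (φ 0).1 ∈ P.feasibleBox) {t : ℝ} (ht : 0 ≤ t) :
    (φ t).1 ∈ P.feasibleBox := by
  intro i _
  have hlip : LocallyLipschitzOn univ fun s : State n m q => s.1 i :=
    (contDiff_pi.1 (contDiff_fst (𝕜 := ℝ) (n := 1)) i).locallyLipschitz.locallyLipschitzOn
  refine (hA.convex i).mem_of_add_deriv_mem (hA.closed i) ht
    ((hφ.absolutelyContinuous le_rfl ht).comp_locallyLipschitzOn hlip (mapsTo_univ _ _))
    (h0 i trivial) ?_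
  filter_upwards [hφ.ae_hasDerivAt] with r hr hm
  obtain ⟨v, ⟨g, -, hp, -, -⟩, hv⟩ := hr hm.1
  refine ⟨v.1 i, hasDerivAt_pi.1 hv.fst i, ?_⟩
  rw [hp i, add_sub_cancel]
  exact proj_mem (hA.nonempty i) (hA.closed i) (hA.convex i) _

/-- The squared distance, up to a factor, of a state to an equilibrium. -/
noncomputable def halfDistSq (xs : (i : Fin n) → Vec (q i)) (l : Vec m) (zs : Fin n → Vec m)
    (s : State n m q) : ℝ :=
  2⁻¹ * (∑ i, ‖s.1 i - xs i‖ ^ 2 + ∑ i, ‖s.2.1 i - l‖ ^ 2 + ∑ i, ‖s.2.2 i - zs i‖ ^ 2)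

theorem halfDistSq_nonneg (xs : (i : Fin n) → Vec (q i)) (l : Vec m) (zs : Fin n → Vec m)
    (s : State n m q) : 0 ≤ halfDistSq xs l zs s := by
  unfold halfDistSq
  positivity

theorem dist_le_of_halfDistSq_le {xs : (i : Fin n) → Vec (q i)} {l : Vec m}
    {zs : Fin n → Vec m} {s : State n m q} {c : ℝ} (h : halfDistSq xs l zs s ≤ c) :
    dist s (xs, (fun _ => l), zs) ≤ √(2 * c) := by
  unfold halfDistSq at h
  have h1 : 0 ≤ ∑ i, ‖s.1 i - xs i‖ ^ 2 := by positivity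
  have h2 : 0 ≤ ∑ i, ‖s.2.1 i - l‖ ^ 2 := by positivity
  have h3 : 0 ≤ ∑ i, ‖s.2.2 i - zs i‖ ^ 2 := by positivity
  have hsingle : ∀ {r : Fin n → ℝ} (i : Fin n), ∑ i, r i ^ 2 ≤ 2 * c → r i ≤ √(2 * c) :=
    fun i hr => Real.le_sqrt_of_sq_le
      ((Finset.single_le_sum (fun j _ => sq_nonneg _) (Finset.mem_univ i)).trans hr)
  refine max_le ?_ (max_le ?_ ?_)
  · refine (dist_pi_le_iff (Real.sqrt_nonneg _)).2 fun i => ?_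
    rw [dist_eq_norm]
    exact hsingle (r := fun i => ‖s.1 i - xs i‖) i (by linarith)
  · refine (dist_pi_le_iff (Real.sqrt_nonneg _)).2 fun i => ?_
    rw [dist_eq_norm]
    exact hsingle (r := fun i => ‖s.2.1 i - l‖) i (by linarith)
  · refine (dist_pi_le_iff (Real.sqrt_nonneg _)).2 fun i => ?_
    rw [dist_eq_norm]
    exact hsingle (r := fun i => ‖s.2.2 i - zs i‖) i (by linarith)

theorem contDiff_halfDistSq (xs : (i : Fin n) → Vec (q i)) (l : Vec m) (zs : Fin n → Vec m) :
    ContDiff ℝ 1 (halfDistSq xs l zs) := by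
  unfold halfDistSq
  refine contDiff_const.mul (((ContDiff.sum fun i _ => ContDiff.norm_sq ℝ ?_).add
    (ContDiff.sum fun i _ => ContDiff.norm_sq ℝ ?_)).add
    (ContDiff.sum fun i _ => ContDiff.norm_sq ℝ ?_))
  · exact (contDiff_pi.1 contDiff_fst i).sub contDiff_const
  · fun_prop
  · fun_prop

theorem hasDerivAt_halfDistSq (xs : (i : Fin n) → Vec (q i)) (l : Vec m) (zs : Fin n → Vec m)
    {v : State n m q} {t : ℝ} (hv : HasDerivAt φ v t) :
    HasDerivAt (fun r => halfDistSq xs l zs (φ r))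
      (∑ i, inner ℝ ((φ t).1 i - xs i) (v.1 i) + ∑ i, inner ℝ ((φ t).2.1 i - l) (v.2.1 i) +
        ∑ i, inner ℝ ((φ t).2.2 i - zs i) (v.2.2 i)) t := by
  have h1 : ∀ i, HasDerivAt (fun r => ‖(φ r).1 i - xs i‖ ^ 2)
      (2 * inner ℝ ((φ t).1 i - xs i) (v.1 i)) t := fun i =>
    ((hasDerivAt_pi.1 hv.fst i).sub_const _).norm_sq
  have h2 : ∀ i, HasDerivAt (fun r => ‖(φ r).2.1 i - l‖ ^ 2)
      (2 * inner ℝ ((φ t).2.1 i - l) (v.2.1 i)) t := fun i =>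
    ((hasDerivAt_pi.1 hv.snd.fst i).sub_const _).norm_sq
  have h3 : ∀ i, HasDerivAt (fun r => ‖(φ r).2.2 i - zs i‖ ^ 2)
      (2 * inner ℝ ((φ t).2.2 i - zs i) (v.2.2 i)) t := fun i =>
    ((hasDerivAt_pi.1 hv.snd.snd i).sub_const _).norm_sq
  have h := (((HasDerivAt.fun_sum fun i (_ : i ∈ Finset.univ) => h1 i).fun_add
    (HasDerivAt.fun_sum fun i (_ : i ∈ Finset.univ) => h2 i)).fun_add
    (HasDerivAt.fun_sum fun i (_ : i ∈ Finset.univ) => h3 i)).const_mul (2⁻¹ : ℝ)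
  refine h.congr_deriv ?_
  simp only [← Finset.mul_sum]
  ring

/-- Along a curve in the feasible box the duality gap is supported from below by a differentiable
function. -/
theorem StandingAssumption.exists_gap_lower_support (hA : StandingAssumption G P) (l : Vec m)
    (xs : (i : Fin n) → Vec (q i)) {v : State n m q} {g : (i : Fin n) → Vec (q i)} {t : ℝ}
    (hbox : ∀ᶠ r in 𝓝 t, (φ r).1 ∈ P.feasibleBox)
    (hg : ∀ i, g i ∈ clarkeGradient (P.f i) ((φ t).1 i)) (hv : HasDerivAt φ v t) :
    ∃ k, HasDerivAt k (∑ i, inner ℝ (g i - P.applyWT i l) (v.1 i)) t ∧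
      k t = P.gap l xs (φ t).1 ∧ ∀ᶠ r in 𝓝 t, k r ≤ P.gap l xs (φ r).1 := by
  choose U hUo hΩU hU using hA.strictConvex
  -- The support is the affine minorant of the gap with subgradient `g - Wᵀ l`, composed with the
  -- curve.
  refine ⟨fun r => P.gap l xs (φ t).1 +
    ∑ i, inner ℝ (g i - P.applyWT i l) ((φ r).1 i - (φ t).1 i), ?_, by simp, ?_⟩
  · refine HasDerivAt.const_add _ (HasDerivAt.fun_sum fun i _ => ?_)
    have := (hasDerivAt_const t (g i - P.applyWT i l)).inner ℝ
      ((hasDerivAt_pi.1 hv.fst i).sub_const ((φ t).1 i))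
    simpa using this
  · have ht := hbox.self_of_nhds
    filter_upwards [hbox] with r hr
    exact Problem.gap_subgradient hUo (fun i => (hU i).convexOn) l
      (fun i => hΩU i (ht i trivial)) (fun i => hΩU i (hr i trivial)) hg

/-- Boundedness and convergence of the solutions of the algorithm. -/
theorem StandingAssumption.isBounded_and_tendsto (hA : StandingAssumption G P)
    (hd : ∑ i, d i = P.d₀) {xs : (i : Fin n) → Vec (q i)} (hxs : P.IsOptimal xs)
    (hφ : IsSolution (ddfa G P d) φ) (h0 : (φ 0).1 ∈ P.feasibleBox) :
    Bornology.IsBounded (φ '' Ici 0) ∧ Tendsto (fun t => (φ t).1) atTop (𝓝 xs) := by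
  obtain ⟨l, hl⟩ := hA.exists_multiplier hxs
  -- The right-hand side has zero sum because both `d` and `W xs` sum to `d₀`.
  obtain ⟨zs, hzs⟩ := WeightedGraph.exists_lap_eq hA.connected
    (b := fun i => d i - P.applyW i (xs i)) (by
      rw [Finset.sum_sub_distrib, hd, sub_eq_zero]
      exact hxs.2.1.symm)
  have hbox : ∀ t, 0 ≤ t → (φ t).1 ∈ P.feasibleBox := fun t ht => hA.mem_feasibleBox hφ h0 ht
  have hbox' : ∀ t, 0 < t → ∀ᶠ r in 𝓝 t, (φ r).1 ∈ P.feasibleBox := by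
    intro t ht
    filter_upwards [lt_mem_nhds ht] with r hr using hbox r hr.le
  set h : ℝ → ℝ := fun t => P.gap l xs (φ t).1 with hh
  set u : ℝ → ℝ := fun t => h t + halfDistSq xs l zs (φ t) with hu
  have hh0 : ∀ t, 0 ≤ t → 0 ≤ h t := fun t ht => hl _ (hbox t ht)
  have hu0 : ∀ t, 0 ≤ t → 0 ≤ u t := fun t ht => add_nonneg (hh0 t ht) (halfDistSq_nonneg _ _ _ _)
  have hhac : ∀ a b, 0 ≤ a → a ≤ b → AbsolutelyContinuousOnInterval h a b := by
    intro a b ha hab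
    have hfst : LocallyLipschitzOn univ fun s : State n m q => s.1 :=
      (ContDiff.locallyLipschitz (𝕂 := ℝ) (by fun_prop)).locallyLipschitzOn
    refine ((hφ.absolutelyContinuous ha hab).comp_locallyLipschitzOn hfst
      (mapsTo_univ _ _)).comp_locallyLipschitzOn (hA.locallyLipschitzOn_gap l xs) fun t ht => ?_
    rw [uIcc_of_le hab] at ht
    exact hbox t (ha.trans ht.1)
  have huac : ∀ a b, 0 ≤ a → a ≤ b → AbsolutelyContinuousOnInterval u a b := by
    intro a b ha hab
    exact (hhac a b ha hab).fun_add ((hφ.absolutelyContinuous ha hab).comp_locallyLipschitzOn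
      (contDiff_halfDistSq xs l zs).locallyLipschitz.locallyLipschitzOn (mapsTo_univ _ _))
  have hsu : ∀ᵐ t, 0 < t →
      ∃ k κ, HasDerivAt k κ t ∧ k t = u t ∧ (∀ᶠ s in 𝓝 t, k s ≤ u s) ∧ κ ≤ -h t := by
    filter_upwards [hφ.ae_hasDerivAt] with t ht ht0
    obtain ⟨v, ⟨g, hg, hp, hμ, hζ⟩, hv⟩ := ht ht0
    obtain ⟨k, hk1, hk2, hk3⟩ := hA.exists_gap_lower_support l xs (hbox' t ht0) hg hv
    refine ⟨_, _, hk1.fun_add (hasDerivAt_halfDistSq xs l zs hv), by rw [hk2], ?_,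
      hA.dissipation l hxs.1 hzs (hbox t ht0.le) hg hp hμ hζ⟩
    filter_upwards [hk3] with r hr
    exact add_le_add_left hr _
  have hanti : AntitoneOn u (Ici 0) := by
    refine antitoneOn_of_lower_support huac ?_
    filter_upwards [hsu] with t ht ht0
    obtain ⟨k, κ, h1, h2, h3, h4⟩ := ht ht0
    exact ⟨k, κ, h1, h2, h3, h4.trans (by linarith [hh0 t ht0.le])⟩
  set K := Metric.closedBall ((xs, (fun _ => l), zs) : State n m q) √(2 * u 0) with hK
  have hmem : ∀ t, 0 ≤ t → φ t ∈ K := by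
    intro t ht
    have h1 : u t ≤ u 0 := hanti (mem_Ici.2 le_rfl) (mem_Ici.2 ht) ht
    have h2 : halfDistSq xs l zs (φ t) ≤ u 0 := by linarith [hh0 t ht]
    exact dist_le_of_halfDistSq_le h2
  have hKc : IsCompact K := isCompact_closedBall _ _
  refine ⟨Metric.isBounded_closedBall.subset (image_subset_iff.2 fun t ht => hmem t ht), ?_⟩
  -- Boundedness of `λ`, already known from `K`, bounds the growth rate of the gap.
  obtain ⟨C, hC⟩ : ∃ C, ∀ s ∈ K, ‖∑ i, ‖P.applyWT i (s.2.1 i - l)‖ ^ 2‖ ≤ C := by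
    refine hKc.exists_bound_of_continuousOn (Continuous.continuousOn ?_)
    refine continuous_finsetSum _ fun i _ => Continuous.pow (Continuous.norm ?_) 2
    exact (LinearMap.continuous_of_finiteDimensional _).comp (by fun_prop)
  have hlim : Tendsto h atTop (𝓝 0) := by
    refine tendsto_zero_of_dissipation (C := |C|) (abs_nonneg C) huac hhac hu0 hh0 hsu ?_
    filter_upwards [hφ.ae_hasDerivAt] with t ht ht0
    obtain ⟨v, ⟨g, hg, hp, -, -⟩, hv⟩ := ht ht0
    obtain ⟨k, hk1, hk2, hk3⟩ := hA.exists_gap_lower_support l xs (hbox' t ht0) hg hv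
    refine ⟨k, _, hk1, hk2, hk3, (hA.gap_rate_le l (hbox t ht0.le) hp).trans ?_⟩
    exact (le_abs_self _).trans ((hC _ (hmem t ht0.le)).trans (le_abs_self C))
  have hcl : IsClosed P.feasibleBox := isClosed_set_pi fun i _ => hA.closed i
  refine ((hKc.image continuous_fst).inter_left hcl).tendsto_of_tendsto_zero
    ((hA.locallyLipschitzOn_gap l xs).continuousOn.mono inter_subset_left)
    (fun x hx hne => hA.gap_pos hxs.1 hl hx.1 hne) ?_ hlim
  filter_upwards [eventually_ge_atTop 0] with t ht
  exact ⟨hbox t ht, mem_image_of_mem _ (hmem t ht)⟩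

end EMO

theorem theorem4 {n m : ℕ} {q : Fin n → ℕ} (G : EMO.WeightedGraph n) (P : EMO.Problem n m q)
    (d : Fin n → EMO.Vec m) (hd : ∑ i, d i = P.d₀)
    (hA : EMO.StandingAssumption G P)
    (hconv : ∀ s : EMO.State n m q, s.1 ∈ P.feasibleBox → Convex ℝ (EMO.ddfa G P d s))
    (hopt : ∃ x, P.IsOptimal x) :
    ∃ xs, (P.IsOptimal xs ∧ ∀ y, P.IsOptimal y → y = xs) ∧
      ∀ φ : ℝ → EMO.State n m q, EMO.IsSolution (EMO.ddfa G P d) φ →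
        (φ 0).1 ∈ P.feasibleBox →
        Bornology.IsBounded (φ '' Set.Ici 0) ∧
        Filter.Tendsto (fun t => (φ t).1) Filter.atTop (nhds xs) := by
  obtain ⟨xs, hxs⟩ := hopt
  exact ⟨xs, ⟨hxs, fun y hy => hA.unique_optimal hxs hy⟩,
    fun φ hφ h0 => hA.isBounded_and_tendsto hd hxs hφ h0⟩
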